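/- Let $\mathrm{L}^2(\mathbf{R})$ be the complex Hilbert space of square-integrable functions $\mathbf{R}\to\mathbf{C}$, let $\hat f$ be the Fourier transform of $f$, let $I$ be the identity operator, and let $H$ be the Hilbert transform, the bounded operator on $\mathrm{L}^2(\mathbf{R})$ given by $\widehat{Hf}(\omega)=-i\,\mathrm{sign}(\omega)\hat f(\omega)$. Call a bounded linear operator $T$ on $\mathrm{L}^2(\mathbf{R})$ \emph{invariant to translations and dilations} if $T\{f(\cdot-y)\}(x)=(Tf)(x-y)$ for all $y\in\mathbf{R}$ and $T\{f(\lambda\,\cdot)\}(x)=(Tf)(\lambda x)$ for all $\lambda>0$, for every $f\in\mathrm{L}^2(\mathbf{R})$ and almost every $x$. (i) (Uniqueness of the fractional Hilbert transform.) A bounded linear operator $T$ on $\mathrm{L}^2(\mathbf{R})$ is unitary, maps real-valued functions to real-valued functions, and is invariant to translations and dilations if and only if $$T=\cos\theta\, I-\sin\theta\, H$$ for some unique $\theta\in(-\pi,\pi]$. In particular, a unitary operator that maps real-valued functions to real-valued functions is invariant to translations and dilations if and only if it has this form. (ii) Without the reality condition: a bounded linear operator $T$ on $\mathrm{L}^2(\mathbf{R})$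 is unitary and invariant to translations and dilations if and only if there is a unique pair $(c_1,c_2)$ of complex numbers with $|c_1|=|c_2|=1$ such that, for every $f\in\mathrm{L}^2(\mathbf{R})$, $\widehat{Tf}(\omega)=c_1\hat f(\omega)$ for almost every $\omega>0$ and $\widehat{Tf}(\omega)=c_2\hat f(\omega)$ for almost every $\omega<0$. Moreover, every such pair $(c_1,c_2)$ is attained by some $T$. -/

import Mathlib

open MeasureTheory
open scoped ENNReal FourierTransform

noncomputable section

/-- The complex Hilbert space `L²(ℝ)` of (classes of) square-integrable functions `ℝ → ℂ`. -/
abbrev L2R : Type := Lp (α := ℝ) ℂ 2 (volume : Measure ℝ)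

/-- Translation by `y`: the function `x ↦ f (x - y)`. -/
def translateL2 (y : ℝ) (f : L2R) : L2R :=
  Lp.compMeasurePreserving (fun x : ℝ => x - y) (measurePreserving_sub_right volume y) f

theorem memLp_comp_mul_left {a : ℝ} (ha : 0 < a) (f : L2R) :
    MemLp (fun x : ℝ => f (a * x)) 2 (volume : Measure ℝ) := by
  have h : MemLp (f : ℝ → ℂ) 2 (Measure.map (a * ·) (volume : Measure ℝ)) := by
    rw [Real.map_volume_mul_left ha.ne']
    exact (Lp.memLp f).smul_measure ENNReal.ofReal_ne_top
  exact h.comp_of_map (measurable_const_mul a).aemeasurable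

/-- Dilation by `a > 0`: the function `x ↦ f (a x)`. -/
def dilateL2 (a : ℝ) (ha : 0 < a) (f : L2R) : L2R :=
  (memLp_comp_mul_left ha f).toLp (fun x : ℝ => f (a * x))

/-- `T` commutes with all translations. -/
def TranslationInvariant (T : L2R →L[ℂ] L2R) : Prop :=
  ∀ (y : ℝ) (f : L2R), T (translateL2 y f) = translateL2 y (T f)

/-- `T` commutes with all dilations by positive factors. -/
def DilationInvariant (T : L2R →L[ℂ] L2R) : Prop :=
  ∀ (a : ℝ) (ha : 0 < a) (f : L2R), T (dilateL2 a ha f) = dilateL2 a ha (T f)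

/-- `T` maps real-valued functions to real-valued functions (almost everywhere). -/
def MapsRealToReal (T : L2R →L[ℂ] L2R) : Prop :=
  ∀ f : L2R, (∀ᵐ x : ℝ, (f x).im = 0) → ∀ᵐ x : ℝ, ((T f) x).im = 0

theorem memLp_hilbertSymbol :
    MemLp (fun ω : ℝ => -Complex.I * (Real.sign ω : ℂ)) ∞ (volume : Measure ℝ) := by
  have hm : Measurable Real.sign := by
    unfold Real.sign
    exact Measurable.ite measurableSet_Iio measurable_const
      (Measurable.ite measurableSet_Ioi measurable_const measurable_const)
  refine memLp_top_of_bound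
    ((Complex.measurable_ofReal.comp hm).const_mul _).aestronglyMeasurable 1
    (Filter.Eventually.of_forall fun ω => ?_)
  rcases Real.sign_apply_eq ω with h | h | h <;> simp [h]

/-- The symbol `ω ↦ -i sign ω` of the Hilbert transform, as an element of `L^∞(ℝ)`. -/
def hilbertSymbol : Lp (α := ℝ) ℂ ∞ (volume : Measure ℝ) :=
  memLp_hilbertSymbol.toLp (fun ω : ℝ => -Complex.I * (Real.sign ω : ℂ))

/-- The Hilbert transform on `L²(ℝ)`: Fourier transform, then multiplication by `-i sign ω`,
then inverse Fourier transform. (The symbol depends only on the sign of the frequency, so the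
normalization of the frequency variable in the Fourier transform does not matter.) -/
def hilbertTransform : L2R →L[ℂ] L2R :=
  ((Lp.fourierTransformₗᵢ ℝ ℂ).symm.toContinuousLinearEquiv : L2R →L[ℂ] L2R) ∘L
    (ContinuousLinearMap.holderL volume ∞ 2 2 (ContinuousLinearMap.mul ℂ ℂ) hilbertSymbol) ∘L
    ((Lp.fourierTransformₗᵢ ℝ ℂ).toContinuousLinearEquiv : L2R →L[ℂ] L2R)

/-- `T` is the Fourier multiplier operator whose symbol is `c₁` on the positive frequencies and
`c₂` on the negative ones. -/
def HasHalfLineSymbol (T : L2R →L[ℂ] L2R) (c₁ c₂ : ℂ) : Prop :=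
  ∀ f : L2R, ∀ᵐ ω : ℝ, (𝓕 (T f)) ω = (if 0 < ω then c₁ else c₂) * (𝓕 f) ω

end

/-! The Fourier transform turns translations into modulations, and an operator commuting with all
modulations is multiplication by a function `m` (`TranslationInvariant.exists_multiplier`).
Dilations become dilations in frequency, so dilation invariance gives `m (a * ω) = m ω` for almost
every `ω`, for each `a > 0`; hence `m` is a constant `c₁` on the positive half-line and `c₂` on the
negative one (`exists_hasHalfLineSymbol`). The rest is read off the two constants: unitarity means
`|c₁| = |c₂| = 1`, and preserving real functions means that `c₂` is the conjugate of `c₁`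
(`HasHalfLineSymbol.mapsRealToReal_iff`). With both, `c₁ = exp (iθ)`, which is the symbol of `cos θ
I - sin θ H`. -/

noncomputable section

open SchwartzMap

/-! ### Multiplication, translation, dilation, conjugation and reflection on `L²` -/

/-- Multiplication by an essentially bounded function, as an operator on `L²(ℝ)`. -/
def mulSymbol (φ : ℝ → ℂ) (hφ : MemLp φ ∞ (volume : Measure ℝ)) : L2R →L[ℂ] L2R :=
  ContinuousLinearMap.holderL volume ∞ 2 2 (ContinuousLinearMap.mul ℂ ℂ) (hφ.toLp φ)

theorem coeFn_mulSymbol {φ : ℝ → ℂ} (hφ : MemLp φ ∞ (volume : Measure ℝ)) (f : L2R) :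
    mulSymbol φ hφ f =ᵐ[volume] fun x => φ x * f x := by
  have h := ContinuousLinearMap.coeFn_holder (r := 2) (ContinuousLinearMap.mul ℂ ℂ)
    (hφ.toLp φ) f
  filter_upwards [h, hφ.coeFn_toLp] with x h1 h2
  rw [← h2]
  exact h1

theorem coeFn_translateL2 (y : ℝ) (f : L2R) :
    translateL2 y f =ᵐ[volume] fun x => f (x - y) :=
  Lp.coeFn_compMeasurePreserving f (measurePreserving_sub_right volume y)

theorem coeFn_dilateL2 {a : ℝ} (ha : 0 < a) (f : L2R) :
    dilateL2 a ha f =ᵐ[volume] fun x => f (a * x) :=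
  (memLp_comp_mul_left ha f).coeFn_toLp

theorem quasiMeasurePreserving_mul_left {a : ℝ} (ha : a ≠ 0) :
    Measure.QuasiMeasurePreserving (fun x : ℝ => a * x) volume volume := by
  refine ⟨measurable_const_mul a, ?_⟩
  rw [Real.map_volume_mul_left ha]
  exact Measure.smul_absolutelyContinuous

theorem continuous_translateL2 (y : ℝ) : Continuous (translateL2 y) :=
  (Lp.isometry_compMeasurePreserving (measurePreserving_sub_right volume y)).continuous

theorem dilateL2_sub {a : ℝ} (ha : 0 < a) (f g : L2R) :
    dilateL2 a ha (f - g) = dilateL2 a ha f - dilateL2 a ha g := by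
  apply Lp.ext
  filter_upwards [coeFn_dilateL2 ha (f - g), coeFn_dilateL2 ha f, coeFn_dilateL2 ha g,
    Lp.coeFn_sub (dilateL2 a ha f) (dilateL2 a ha g),
    (quasiMeasurePreserving_mul_left ha.ne').ae (Lp.coeFn_sub f g)] with x h1 h2 h3 h4 h5
  rw [h1, h4, Pi.sub_apply, h2, h3, h5, Pi.sub_apply]

theorem norm_dilateL2 {a : ℝ} (ha : 0 < a) (f : L2R) :
    ‖dilateL2 a ha f‖ = (ENNReal.ofReal |a⁻¹| ^ (1 / 2 : ℝ)).toReal * ‖f‖ := by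
  have h : eLpNorm (fun x => f (a * x)) 2 volume =
      eLpNorm f 2 (Measure.map (a * ·) (volume : Measure ℝ)) := by
    rw [eLpNorm_map_measure _ (measurable_const_mul a).aemeasurable]
    · rfl
    · rw [Real.map_volume_mul_left ha.ne']
      exact (Lp.aestronglyMeasurable f).smul_measure _
  rw [dilateL2, Lp.norm_toLp, h, Real.map_volume_mul_left ha.ne',
    eLpNorm_smul_measure_of_ne_zero, smul_eq_mul, ENNReal.toReal_mul, Lp.norm_def]
  · norm_num
  · simpa using ha.ne'

theorem continuous_dilateL2 {a : ℝ} (ha : 0 < a) : Continuous (dilateL2 a ha) := by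
  refine (LipschitzWith.of_dist_le_mul (K := (ENNReal.ofReal |a⁻¹| ^ (1 / 2 : ℝ)).toNNReal)
    fun f g => ?_).continuous
  rw [dist_eq_norm, dist_eq_norm, ← dilateL2_sub, norm_dilateL2]
  rfl

theorem continuous_star_L2 : Continuous (star : L2R → L2R) := by
  refine (LipschitzWith.of_dist_le_mul (K := 1) fun f g => ?_).continuous
  have h : star f - star g = star (f - g) := by
    apply Lp.ext
    filter_upwards [Lp.coeFn_star (f - g), Lp.coeFn_star f, Lp.coeFn_star g,
      Lp.coeFn_sub (star f) (star g), Lp.coeFn_sub f g] with x h1 h2 h3 h4 h5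
    rw [h1, h4, Pi.sub_apply, Pi.star_apply, h2, h3, h5, Pi.sub_apply, star_sub]
    rfl
  rw [dist_eq_norm, dist_eq_norm, h, Lp.norm_def, Lp.norm_def,
    eLpNorm_congr_ae (Lp.coeFn_star (f - g)), eLpNorm_star]
  simp

/-- Reflection: the function `x ↦ f (-x)`. -/
def reflectL2 (f : L2R) : L2R :=
  Lp.compMeasurePreserving (fun x : ℝ => -x) (Measure.measurePreserving_neg volume) f

theorem coeFn_reflectL2 (f : L2R) : reflectL2 f =ᵐ[volume] fun x => f (-x) :=
  Lp.coeFn_compMeasurePreserving f (Measure.measurePreserving_neg volume)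

theorem continuous_reflectL2 : Continuous reflectL2 :=
  (Lp.isometry_compMeasurePreserving (Measure.measurePreserving_neg volume)).continuous

/-- Schwartz functions are dense in `L²`. This reduces identities for the `L²` Fourier transform,
which has no pointwise formula, to computations with integrals. -/
theorem eq_of_eq_on_schwartz {A B : L2R → L2R} (hA : Continuous A) (hB : Continuous B)
    (h : ∀ g : 𝓢(ℝ, ℂ), A (g.toLp 2) = B (g.toLp 2)) (f : L2R) : A f = B f := by
  refine congrFun (DenseRange.equalizer
    (SchwartzMap.denseRange_toLpCLM (F := ℂ) (μ := (volume : Measure ℝ)) (p := 2)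
      ENNReal.ofNat_ne_top) hA hB ?_) f
  ext1 g
  exact h g

theorem continuous_fourier_L2 : Continuous (𝓕 : L2R → L2R) :=
  (Lp.fourierTransformₗᵢ ℝ ℂ).continuous

theorem fourier_L2_injective : Function.Injective (𝓕 : L2R → L2R) :=
  (Lp.fourierTransformₗᵢ ℝ ℂ).injective

/-! ### How the Fourier transform intertwines translation, dilation and conjugation -/

/-- The symbol of the translation by `y`. -/
def translationSymbol (y ω : ℝ) : ℂ := Real.fourierChar (-(y * ω))

theorem continuous_translationSymbol (y : ℝ) : Continuous (translationSymbol y) := by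
  unfold translationSymbol
  exact continuous_subtype_val.comp (Real.continuous_fourierChar.comp (by fun_prop))

theorem norm_translationSymbol (y ω : ℝ) : ‖translationSymbol y ω‖ = 1 := by
  exact Circle.norm_coe _

theorem memLp_translationSymbol (y : ℝ) :
    MemLp (translationSymbol y) ∞ (volume : Measure ℝ) :=
  memLp_top_of_bound (continuous_translationSymbol y).aestronglyMeasurable 1
    (Filter.Eventually.of_forall fun ω => (norm_translationSymbol y ω).le)

theorem fourier_translateL2 (y : ℝ) (f : L2R) :
    𝓕 (translateL2 y f) = mulSymbol (translationSymbol y) (memLp_translationSymbol y) (𝓕 f) := by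
  refine eq_of_eq_on_schwartz (A := fun f => 𝓕 (translateL2 y f))
    (B := fun f => mulSymbol (translationSymbol y) (memLp_translationSymbol y) (𝓕 f))
    (continuous_fourier_L2.comp (continuous_translateL2 y))
    ((ContinuousLinearMap.continuous _).comp continuous_fourier_L2) (fun g => ?_) f
  have h1 : translateL2 y (g.toLp 2) = (g.compSubConstCLM ℂ y).toLp 2 := by
    apply Lp.ext
    filter_upwards [coeFn_translateL2 y (g.toLp 2), SchwartzMap.coeFn_toLp
      (g.compSubConstCLM ℂ y) 2 volume, (measurePreserving_sub_right volume y
        ).quasiMeasurePreserving.ae (g.coeFn_toLp 2 volume)] with x e1 e2 e3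
    rw [e1, e2, e3, compSubConstCLM_apply]
  simp only [h1, SchwartzMap.toLp_fourier_eq]
  apply Lp.ext
  filter_upwards [coeFn_mulSymbol (memLp_translationSymbol y) ((𝓕 g).toLp 2),
    (𝓕 g).coeFn_toLp 2 volume, SchwartzMap.coeFn_toLp (𝓕 (g.compSubConstCLM ℂ y)) 2 volume]
    with ω e1 e2 e3
  rw [e1, e2, e3, fourier_coe, fourier_coe, Real.fourier_real_eq, Real.fourier_real_eq,
    ← integral_add_right_eq_self _ y, ← integral_const_mul]
  refine integral_congr_ae (Filter.Eventually.of_forall fun v => ?_)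
  simp only [compSubConstCLM_apply, add_sub_cancel_right, translationSymbol, Circle.smul_def,
    smul_eq_mul, ← mul_assoc, ← Circle.coe_mul, ← AddChar.map_add_eq_mul]
  congr 3
  ring

theorem fourier_dilateL2 {a : ℝ} (ha : 0 < a) (f : L2R) :
    𝓕 (dilateL2 a ha f) = ((a⁻¹ : ℝ) : ℂ) • dilateL2 a⁻¹ (inv_pos.2 ha) (𝓕 f) := by
  refine eq_of_eq_on_schwartz (A := fun f => 𝓕 (dilateL2 a ha f))
    (B := fun f => ((a⁻¹ : ℝ) : ℂ) • dilateL2 a⁻¹ (inv_pos.2 ha) (𝓕 f))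
    (continuous_fourier_L2.comp (continuous_dilateL2 ha))
    (((continuous_dilateL2 (inv_pos.2 ha)).comp continuous_fourier_L2).const_smul
      ((a⁻¹ : ℝ) : ℂ)) (fun g => ?_) f
  set d : 𝓢(ℝ, ℂ) := compCLMOfContinuousLinearEquiv ℂ
    (ContinuousLinearEquiv.unitsEquivAut ℝ (Units.mk0 a ha.ne')) g with hd
  have hdx : ∀ x, d x = g (a * x) := fun x => by simp [hd, mul_comm]
  have h1 : dilateL2 a ha (g.toLp 2) = d.toLp 2 := by
    apply Lp.ext
    filter_upwards [coeFn_dilateL2 ha (g.toLp 2), d.coeFn_toLp 2 volume,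
      (quasiMeasurePreserving_mul_left ha.ne').ae (g.coeFn_toLp 2 volume)] with x e1 e2 e3
    rw [e1, e2, e3, hdx]
  simp only [h1, SchwartzMap.toLp_fourier_eq]
  apply Lp.ext
  filter_upwards [coeFn_dilateL2 (inv_pos.2 ha) ((𝓕 g).toLp 2),
    (quasiMeasurePreserving_mul_left (inv_pos.2 ha).ne').ae ((𝓕 g).coeFn_toLp 2 volume),
    (𝓕 d).coeFn_toLp 2 volume, Lp.coeFn_smul ((a⁻¹ : ℝ) : ℂ)
      (dilateL2 a⁻¹ (inv_pos.2 ha) ((𝓕 g).toLp 2))] with ω e1 e2 e3 e4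
  rw [e4, Pi.smul_apply, e1, e2, e3, fourier_coe, fourier_coe, Real.fourier_real_eq,
    Real.fourier_real_eq]
  have := Measure.integral_comp_mul_left
    (fun v : ℝ => Real.fourierChar (-(v * (a⁻¹ * ω))) • g v) a
  rw [abs_of_pos (inv_pos.2 ha)] at this
  rw [Complex.coe_smul, ← this]
  refine integral_congr_ae (Filter.Eventually.of_forall fun v => ?_)
  simp only [hdx]
  congr 3
  field_simp

theorem fourier_star_L2 (f : L2R) : 𝓕 (star f) = reflectL2 (star (𝓕 f)) := by
  refine eq_of_eq_on_schwartz (A := fun f => 𝓕 (star f))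
    (B := fun f => reflectL2 (star (𝓕 f)))
    (continuous_fourier_L2.comp continuous_star_L2)
    (continuous_reflectL2.comp (continuous_star_L2.comp continuous_fourier_L2)) (fun g => ?_) f
  set d : 𝓢(ℝ, ℂ) := SchwartzMap.postcompCLM (𝕜 := ℝ)
    (Complex.conjCLE : ℂ →L[ℝ] ℂ) g with hd
  have hdx : ∀ x, d x = star (g x) := fun x => by simp [hd]
  have h1 : star (g.toLp 2) = d.toLp 2 := by
    apply Lp.ext
    filter_upwards [Lp.coeFn_star (g.toLp 2), d.coeFn_toLp 2 volume,
      g.coeFn_toLp 2 volume] with x e1 e2 e3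
    rw [e1, e2, Pi.star_apply, e3, hdx]
  simp only [h1, SchwartzMap.toLp_fourier_eq]
  apply Lp.ext
  have hn := (Measure.measurePreserving_neg (volume : Measure ℝ)).quasiMeasurePreserving
  filter_upwards [coeFn_reflectL2 (star ((𝓕 g).toLp 2)),
    hn.ae (Lp.coeFn_star ((𝓕 g).toLp 2)), hn.ae ((𝓕 g).coeFn_toLp 2 volume),
    (𝓕 d).coeFn_toLp 2 volume] with ω e1 e2 e3 e4
  rw [e4, e1, e2, Pi.star_apply, e3, fourier_coe, fourier_coe, Real.fourier_real_eq,
    Real.fourier_real_eq, RCLike.star_def, ← integral_conj]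
  refine integral_congr_ae (Filter.Eventually.of_forall fun v => ?_)
  simp [hdx, Circle.smul_def, ← Circle.coe_inv_eq_conj, AddChar.map_neg_eq_inv]

/-! ### Translation-invariant operators are Fourier multipliers -/

/-- A test function `g` is the transform of the Schwartz function `𝓕⁻ g`. Moving the transform
across the pairing gives `∫ g k = ∫ (𝓕⁻ g) (𝓕 k) = 0`. -/
theorem ae_eq_zero_of_fourier_eq_zero {k : ℝ → ℂ} (hk : Integrable k) (h : ∀ y, 𝓕 k y = 0) :
    k =ᵐ[volume] 0 := by
  apply ae_eq_zero_of_integral_contDiff_smul_eq_zero hk.locallyIntegrable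
  intro g g_smooth g_cpt
  have hg₁ : HasCompactSupport (Complex.ofRealCLM ∘ g) := g_cpt.comp_left rfl
  have hg₂ : ContDiff ℝ (⊤ : ℕ∞) (Complex.ofRealCLM ∘ g) := by fun_prop
  set φ : 𝓢(ℝ, ℂ) := hg₁.toSchwartzMap hg₂ with hφ
  have hφx : ∀ x, 𝓕 (𝓕⁻ φ : 𝓢(ℝ, ℂ)) x = (g x : ℂ) := fun x => by
    rw [FourierTransform.fourier_fourierInv_eq]; rfl
  have key := VectorFourier.integral_fourierIntegral_smul_eq_flip (L := innerₗ ℝ)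
    Real.continuous_fourierChar continuous_inner ((𝓕⁻ φ).integrable (μ := volume)) hk
  have e1 : ∀ x, VectorFourier.fourierIntegral Real.fourierChar volume (innerₗ ℝ)
      (𝓕⁻ φ : 𝓢(ℝ, ℂ)) x = (g x : ℂ) := fun x => by
    rw [← hφx, fourier_coe]; rfl
  have e2 : ∀ x, VectorFourier.fourierIntegral Real.fourierChar volume (innerₗ ℝ).flip k x = 0 :=
    fun x => by rw [flip_innerₗ]; exact h x
  simp only [e1, e2, smul_zero, integral_zero] at key
  exact key

theorem fourier_conj_mul_eq_inner (g h : L2R) (y : ℝ) :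
    𝓕 (fun x => inner ℂ (h x) (g x)) y =
      inner ℂ h (mulSymbol (translationSymbol y) (memLp_translationSymbol y) g) := by
  rw [L2.inner_def, Real.fourier_real_eq]
  refine integral_congr_ae ?_
  filter_upwards [coeFn_mulSymbol (memLp_translationSymbol y) g] with x hx
  rw [hx, ← smul_eq_mul (translationSymbol y x), inner_smul_right, Circle.smul_def, smul_eq_mul,
    translationSymbol, mul_comm y x]

/-- A square-integrable function without zeros. -/
theorem exists_L2_ne_zero : ∃ g : L2R, ∀ᵐ x, g x ≠ 0 := by
  have h : MemLp (fun x : ℝ => (Real.exp (-1 * x ^ 2) : ℂ)) 2 volume := by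
    rw [memLp_two_iff_integrable_sq_norm]
    · refine (integrable_exp_neg_mul_sq (b := 2) (by norm_num)).congr
        (Filter.Eventually.of_forall fun x => ?_)
      simp only [Complex.norm_real, Real.norm_eq_abs, Real.abs_exp, ← Real.exp_nat_mul]
      congr 1
      push_cast
      ring
    · exact (by fun_prop : Continuous fun x : ℝ => (Real.exp (-1 * x ^ 2) : ℂ)
        ).aestronglyMeasurable
  refine ⟨h.toLp _, ?_⟩
  filter_upwards [h.coeFn_toLp] with x hx
  rw [hx]
  exact_mod_cast (Real.exp_pos _).ne'

/-- An operator that commutes with all modulations is a multiplication operator. -/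
theorem exists_multiplier_of_commute {S : L2R →L[ℂ] L2R}
    (hS : ∀ (y : ℝ) (g : L2R),
      S (mulSymbol (translationSymbol y) (memLp_translationSymbol y) g) =
        mulSymbol (translationSymbol y) (memLp_translationSymbol y) (S g)) :
    ∃ m : ℝ → ℂ, Measurable m ∧ ∀ g : L2R, S g =ᵐ[volume] fun x => m x * g x := by
  obtain ⟨h, hh⟩ := exists_L2_ne_zero
  set h' : L2R := ContinuousLinearMap.adjoint S h with h'_def
  -- If `S` is multiplication by `m`, its adjoint is multiplication by the conjugate of `m`; applied
  -- to the nowhere vanishing `h`, this forces the choice of `m`.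
  refine ⟨fun x => star (h' x / h x), ?_, fun g => ?_⟩
  · exact continuous_star.measurable.comp ((Lp.stronglyMeasurable h').measurable.div
      (Lp.stronglyMeasurable h).measurable)
  -- With `M_y` the modulation, the transform at `y` of this integrable difference is `⟪h, M_y S g⟫
  -- - ⟪S* h, M_y g⟫`, which vanishes because `S` commutes with `M_y`.
  have key := ae_eq_zero_of_fourier_eq_zero
    ((L2.integrable_inner (𝕜 := ℂ) h (S g)).sub (L2.integrable_inner (𝕜 := ℂ) h' g))
    (fun y => by
      have : 𝓕 (fun x => inner ℂ (h x) (S g x) - inner ℂ (h' x) (g x)) y =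
          𝓕 (fun x => inner ℂ (h x) (S g x)) y - 𝓕 (fun x => inner ℂ (h' x) (g x)) y := by
        simp only [Real.fourier_real_eq, smul_sub]
        refine integral_sub ?_ ?_
        · simpa [mul_comm] using (Real.fourierIntegral_convergent_iff (V := ℝ) y).2
            (L2.integrable_inner (𝕜 := ℂ) h (S g))
        · simpa [mul_comm] using (Real.fourierIntegral_convergent_iff (V := ℝ) y).2
            (L2.integrable_inner (𝕜 := ℂ) h' g)
      refine this.trans ?_
      rw [fourier_conj_mul_eq_inner, fourier_conj_mul_eq_inner, ← hS,
        ContinuousLinearMap.adjoint_inner_left, sub_self])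
  filter_upwards [key, hh] with x hx hx0
  simp only [Pi.sub_apply, Pi.zero_apply, RCLike.inner_apply, sub_eq_zero] at hx
  have h0 : starRingEnd ℂ (h x) ≠ 0 := by simpa using hx0
  rw [RCLike.star_def, map_div₀, div_mul_eq_mul_div, eq_div_iff h0, hx, mul_comm]

theorem TranslationInvariant.exists_multiplier {T : L2R →L[ℂ] L2R} (hT : TranslationInvariant T) :
    ∃ m : ℝ → ℂ, Measurable m ∧ ∀ f : L2R, ∀ᵐ ω : ℝ, (𝓕 (T f)) ω = m ω * (𝓕 f) ω := by
  set F := Lp.fourierTransformₗᵢ ℝ ℂ with hF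
  obtain ⟨m, hm, h⟩ := exists_multiplier_of_commute
    (S := (F.toContinuousLinearEquiv : L2R →L[ℂ] L2R) ∘L T ∘L
      (F.symm.toContinuousLinearEquiv : L2R →L[ℂ] L2R)) (fun y g => by
    have h1 : F.symm (mulSymbol (translationSymbol y) (memLp_translationSymbol y) g) =
        translateL2 y (F.symm g) := by
      rw [LinearIsometryEquiv.symm_apply_eq]
      refine Eq.trans ?_ (fourier_translateL2 y (F.symm g)).symm
      exact congrArg _ (F.apply_symm_apply g).symm
    change F (T (F.symm _)) = _
    rw [h1, hT]
    exact fourier_translateL2 y _)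
  refine ⟨m, hm, fun f => ?_⟩
  have := h (F f)
  simp only [ContinuousLinearMap.comp_apply, ContinuousLinearEquiv.coe_coe,
    LinearIsometryEquiv.coe_toContinuousLinearEquiv, F.symm_apply_apply] at this
  exact this

/-! ### Dilation invariance makes the symbol constant on half-lines -/

theorem ae_eq_comp_mul_of_dilationInvariant {T : L2R →L[ℂ] L2R} (hT : DilationInvariant T)
    {m : ℝ → ℂ} (hm : ∀ f : L2R, ∀ᵐ ω : ℝ, (𝓕 (T f)) ω = m ω * (𝓕 f) ω)
    {a : ℝ} (ha : 0 < a) : ∀ᵐ ω : ℝ, m (a * ω) = m ω := by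
  obtain ⟨g, hg⟩ := exists_L2_ne_zero
  obtain ⟨f, rfl⟩ : ∃ f : L2R, 𝓕 f = g := (Lp.fourierTransformₗᵢ ℝ ℂ).surjective g
  have hb := inv_pos.2 ha
  -- Dilating by `a⁻¹` in space dilates by `a` in frequency.
  have h1 := hm (dilateL2 a⁻¹ hb f)
  rw [hT, fourier_dilateL2, fourier_dilateL2] at h1
  have hq := quasiMeasurePreserving_mul_left (inv_pos.2 hb).ne'
  filter_upwards [h1, Lp.coeFn_smul (((a⁻¹)⁻¹ : ℝ) : ℂ) (dilateL2 _ (inv_pos.2 hb) (𝓕 (T f))),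
    Lp.coeFn_smul (((a⁻¹)⁻¹ : ℝ) : ℂ) (dilateL2 _ (inv_pos.2 hb) (𝓕 f)),
    coeFn_dilateL2 (inv_pos.2 hb) (𝓕 (T f)), coeFn_dilateL2 (inv_pos.2 hb) (𝓕 f),
    hq.ae (hm f), hq.ae hg] with ω e1 e2 e3 e4 e5 e6 e7
  rw [e2, e3, Pi.smul_apply, Pi.smul_apply, e4, e5, e6, smul_eq_mul, smul_eq_mul,
    ← mul_assoc, ← mul_assoc, mul_comm (m ω)] at e1
  have h2 := mul_left_cancel₀ (by simpa using ha.ne') (mul_right_cancel₀ e7 e1)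
  rwa [inv_inv] at h2

theorem exists_pos_of_ae {p : ℝ → Prop} (h : ∀ᵐ x, p x) : ∃ x, 0 < x ∧ p x := by
  have h1 : ∃ᵐ x : ℝ, 0 < x := by
    rw [frequently_ae_iff]
    exact (Real.volume_Ioi (a := 0)).trans_ne ENNReal.top_ne_zero
  exact (h1.and_eventually h).exists

theorem exists_neg_of_ae {p : ℝ → Prop} (h : ∀ᵐ x, p x) : ∃ x, x < 0 ∧ p x := by
  obtain ⟨x, hx, hp⟩ := exists_pos_of_ae
    ((Measure.measurePreserving_neg (volume : Measure ℝ)).quasiMeasurePreserving.ae h)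
  exact ⟨-x, by linarith, hp⟩

/-- The exceptional null set depends on `a`. Fubini supplies one `x > 0` with `m (a * x) = m x` for
almost every `a > 0`, and the substitution `a = x⁻¹ * ω` covers the positive half-line; likewise for
a negative point. -/
theorem ae_eq_const_of_comp_mul {m : ℝ → ℂ} (hm : Measurable m)
    (h : ∀ a : ℝ, 0 < a → ∀ᵐ ω : ℝ, m (a * ω) = m ω) :
    ∃ c₁ c₂ : ℂ, ∀ᵐ ω : ℝ, m ω = if 0 < ω then c₁ else c₂ := by
  have hmeas : MeasurableSet {x : ℝ × ℝ | 0 < x.1 → m (x.1 * x.2) = m x.2} := by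
    have h1 : MeasurableSet {x : ℝ × ℝ | 0 < x.1} := measurableSet_lt measurable_const measurable_fst
    exact h1.imp (measurableSet_eq_fun (hm.comp (measurable_fst.mul measurable_snd))
      (hm.comp measurable_snd))
  have h2 : ∀ᵐ ω : ℝ, ∀ᵐ a : ℝ, 0 < a → m (a * ω) = m ω := by
    refine (Measure.ae_ae_comm (p := fun a ω => 0 < a → m (a * ω) = m ω) hmeas).1
      (Filter.Eventually.of_forall fun a => ?_)
    by_cases ha : 0 < a
    · filter_upwards [h a ha] with ω hω _ using hω
    · exact Filter.Eventually.of_forall fun ω h' => absurd h' ha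
  obtain ⟨x, hx, hx'⟩ := exists_pos_of_ae h2
  obtain ⟨z, hz, hz'⟩ := exists_neg_of_ae h2
  refine ⟨m x, m z, ?_⟩
  filter_upwards [(quasiMeasurePreserving_mul_left (inv_ne_zero hx.ne')).ae hx',
    (quasiMeasurePreserving_mul_left (inv_ne_zero hz.ne)).ae hz', Measure.ae_ne volume 0]
    with ω h3 h4 h0
  split_ifs with hω
  · have := h3 (mul_pos (inv_pos.2 hx) hω)
    rwa [mul_right_comm, inv_mul_cancel₀ hx.ne', one_mul] at this
  · have := h4 (mul_pos_of_neg_of_neg (inv_lt_zero.2 hz) (lt_of_le_of_ne (not_lt.1 hω) h0))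
    rwa [mul_right_comm, inv_mul_cancel₀ hz.ne, one_mul] at this

theorem exists_hasHalfLineSymbol {T : L2R →L[ℂ] L2R} (ht : TranslationInvariant T)
    (hd : DilationInvariant T) : ∃ c₁ c₂ : ℂ, HasHalfLineSymbol T c₁ c₂ := by
  obtain ⟨m, hm, h⟩ := ht.exists_multiplier
  obtain ⟨c₁, c₂, hc⟩ := ae_eq_const_of_comp_mul hm
    fun a ha => ae_eq_comp_mul_of_dilationInvariant hd h ha
  refine ⟨c₁, c₂, fun f => ?_⟩
  filter_upwards [h f, hc] with ω h1 h2
  rw [h1, h2]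

/-! ### Operators with a half-line symbol -/

/-- The function equal to `c₁` on the positive half-line and to `c₂` on the negative one. -/
def halfLineSymbol (c₁ c₂ : ℂ) (ω : ℝ) : ℂ := if 0 < ω then c₁ else c₂

theorem memLp_halfLineSymbol (c₁ c₂ : ℂ) :
    MemLp (halfLineSymbol c₁ c₂) ∞ (volume : Measure ℝ) := by
  refine memLp_top_of_bound
    (Measurable.ite measurableSet_Ioi measurable_const measurable_const).aestronglyMeasurable
    (max ‖c₁‖ ‖c₂‖) (Filter.Eventually.of_forall fun ω => ?_)
  unfold halfLineSymbol
  split_ifs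
  · exact le_max_left _ _
  · exact le_max_right _ _

/-- Conjugation of a multiplication operator by the Fourier transform. -/
def fourierMultiplierL2 (φ : ℝ → ℂ) (hφ : MemLp φ ∞ (volume : Measure ℝ)) : L2R →L[ℂ] L2R :=
  ((Lp.fourierTransformₗᵢ ℝ ℂ).symm.toContinuousLinearEquiv : L2R →L[ℂ] L2R) ∘L
    (mulSymbol φ hφ) ∘L
    ((Lp.fourierTransformₗᵢ ℝ ℂ).toContinuousLinearEquiv : L2R →L[ℂ] L2R)

theorem fourier_fourierMultiplierL2 {φ : ℝ → ℂ} (hφ : MemLp φ ∞ (volume : Measure ℝ)) (f : L2R) :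
    𝓕 (fourierMultiplierL2 φ hφ f) = mulSymbol φ hφ (𝓕 f) :=
  (Lp.fourierTransformₗᵢ ℝ ℂ).apply_symm_apply _

theorem coeFn_fourier_fourierMultiplierL2 {φ : ℝ → ℂ} (hφ : MemLp φ ∞ (volume : Measure ℝ))
    (f : L2R) : ∀ᵐ ω : ℝ, (𝓕 (fourierMultiplierL2 φ hφ f)) ω = φ ω * (𝓕 f) ω := by
  rw [fourier_fourierMultiplierL2]
  exact coeFn_mulSymbol hφ _

theorem hasHalfLineSymbol_fourierMultiplierL2 (c₁ c₂ : ℂ) :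
    HasHalfLineSymbol (fourierMultiplierL2 _ (memLp_halfLineSymbol c₁ c₂)) c₁ c₂ :=
  fun f => coeFn_fourier_fourierMultiplierL2 (memLp_halfLineSymbol c₁ c₂) f

theorem hilbertTransform_eq :
    hilbertTransform = fourierMultiplierL2 _ memLp_hilbertSymbol := rfl

theorem exists_fourier_ne_zero : ∃ f : L2R, ∀ᵐ ω, (𝓕 f) ω ≠ 0 := by
  obtain ⟨g, hg⟩ := exists_L2_ne_zero
  obtain ⟨f, rfl⟩ : ∃ f : L2R, 𝓕 f = g := (Lp.fourierTransformₗᵢ ℝ ℂ).surjective g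
  exact ⟨f, hg⟩

namespace HasHalfLineSymbol

variable {T T' : L2R →L[ℂ] L2R} {c₁ c₂ d₁ d₂ : ℂ}

theorem operator_unique (h : HasHalfLineSymbol T c₁ c₂) (h' : HasHalfLineSymbol T' c₁ c₂) :
    T = T' := by
  ext1 f
  apply fourier_L2_injective
  apply Lp.ext
  filter_upwards [h f, h' f] with ω h1 h2
  rw [h1, h2]

theorem symbol_unique (h : HasHalfLineSymbol T c₁ c₂) (h' : HasHalfLineSymbol T d₁ d₂) :
    c₁ = d₁ ∧ c₂ = d₂ := by
  obtain ⟨f, hf⟩ := exists_fourier_ne_zero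
  have key : ∀ᵐ ω : ℝ, (if 0 < ω then c₁ else c₂) = if 0 < ω then d₁ else d₂ := by
    filter_upwards [h f, h' f, hf] with ω h1 h2 h3
    exact mul_right_cancel₀ h3 (h1.symm.trans h2)
  obtain ⟨x, hx, hx'⟩ := exists_pos_of_ae key
  obtain ⟨z, hz, hz'⟩ := exists_neg_of_ae key
  exact ⟨by simpa [hx] using hx', by simpa [hz.not_gt] using hz'⟩

theorem comp (h : HasHalfLineSymbol T c₁ c₂) (h' : HasHalfLineSymbol T' d₁ d₂) :
    HasHalfLineSymbol (T * T') (c₁ * d₁) (c₂ * d₂) := by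
  intro f
  filter_upwards [h (T' f), h' f] with ω h1 h2
  rw [mul_apply_eq_comp, h1, h2, ← mul_assoc]
  split_ifs <;> rfl

theorem one : HasHalfLineSymbol 1 1 1 := fun f =>
  Filter.Eventually.of_forall fun ω => by simp

theorem norm_map (h : HasHalfLineSymbol T c₁ c₂) (h₁ : ‖c₁‖ = 1) (h₂ : ‖c₂‖ = 1) (f : L2R) :
    ‖T f‖ = ‖f‖ := by
  rw [← Lp.norm_fourier_eq (T f), ← Lp.norm_fourier_eq f, Lp.norm_def, Lp.norm_def]
  congr 1
  apply eLpNorm_congr_norm_ae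
  filter_upwards [h f] with ω hω
  rw [hω, norm_mul]
  split_ifs <;> simp [h₁, h₂]

/-- The isometry property makes `star T` a left inverse only; the multiplier with the inverse
constants is a right inverse, so the two coincide. -/
theorem mem_unitary (h : HasHalfLineSymbol T c₁ c₂) (h₁ : ‖c₁‖ = 1) (h₂ : ‖c₂‖ = 1) :
    T ∈ unitary (L2R →L[ℂ] L2R) := by
  have e₁ : star T * T = 1 := (T.norm_map_iff_adjoint_comp_self).1 (h.norm_map h₁ h₂)
  have hV := hasHalfLineSymbol_fourierMultiplierL2 c₁⁻¹ c₂⁻¹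
  have hc₁ : c₁ ≠ 0 := norm_ne_zero_iff.1 (by simp [h₁])
  have hc₂ : c₂ ≠ 0 := norm_ne_zero_iff.1 (by simp [h₂])
  have e₂ : T * fourierMultiplierL2 _ (memLp_halfLineSymbol c₁⁻¹ c₂⁻¹) = 1 := by
    refine (h.comp hV).operator_unique ?_
    rw [mul_inv_cancel₀ hc₁, mul_inv_cancel₀ hc₂]
    exact one
  rw [Unitary.mem_iff]
  refine ⟨e₁, ?_⟩
  rw [left_inv_eq_right_inv e₁ e₂, e₂]

/-- The indicator of `s` is an eigenvector, with eigenvalue `c`, of the multiplication operator on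
the Fourier side. -/
theorem norm_eq_one_of_eq_on (h : HasHalfLineSymbol T c₁ c₂) (hT : ∀ f, ‖T f‖ = ‖f‖) {s : Set ℝ}
    (hs : MeasurableSet s) (hs0 : volume s ≠ 0) (hs' : volume s ≠ ∞) {c : ℂ}
    (hc : ∀ ω ∈ s, (if 0 < ω then c₁ else c₂) = c) : ‖c‖ = 1 := by
  set g : L2R := indicatorConstLp 2 hs hs' (1 : ℂ) with hg
  have hg0 : ‖g‖ ≠ 0 := by
    rw [hg, norm_indicatorConstLp (by norm_num) (by norm_num)]
    have : 0 < volume.real s := ENNReal.toReal_pos hs0 hs'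
    simp only [norm_one, one_mul]
    positivity
  obtain ⟨f, hf⟩ : ∃ f : L2R, 𝓕 f = g := (Lp.fourierTransformₗᵢ ℝ ℂ).surjective g
  have h1 : 𝓕 (T f) = c • g := by
    apply Lp.ext
    filter_upwards [h f, Lp.coeFn_smul c g,
      indicatorConstLp_coeFn (p := 2) (hs := hs) (hμs := hs') (c := (1 : ℂ))] with ω e1 e2 e3
    rw [e1, e2, hf, Pi.smul_apply, hg, e3, smul_eq_mul]
    by_cases hω : ω ∈ s
    · rw [hc ω hω]
    · simp [hω]
  have h2 := hT f
  rw [← Lp.norm_fourier_eq (T f), ← Lp.norm_fourier_eq f, h1, hf, norm_smul] at h2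
  exact (mul_eq_right₀ hg0).1 h2

theorem norm_eq_one (h : HasHalfLineSymbol T c₁ c₂) (hT : T ∈ unitary (L2R →L[ℂ] L2R)) :
    ‖c₁‖ = 1 ∧ ‖c₂‖ = 1 := by
  have hn : ∀ f, ‖T f‖ = ‖f‖ := ContinuousLinearMap.norm_map_of_mem_unitary hT
  exact ⟨h.norm_eq_one_of_eq_on hn (measurableSet_Ioo (a := (0 : ℝ)) (b := 1)) (by simp) (by simp)
      fun ω hω => if_pos hω.1,
    h.norm_eq_one_of_eq_on hn (measurableSet_Ioo (a := (-1 : ℝ)) (b := 0)) (by simp) (by simp)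
      fun ω hω => if_neg hω.2.not_gt⟩

theorem translationInvariant (h : HasHalfLineSymbol T c₁ c₂) : TranslationInvariant T := by
  intro y f
  apply fourier_L2_injective
  have h1 := h (translateL2 y f)
  rw [fourier_translateL2] at h1
  rw [fourier_translateL2 y (T f)]
  apply Lp.ext
  filter_upwards [h1, h f, coeFn_mulSymbol (memLp_translationSymbol y) (𝓕 f),
    coeFn_mulSymbol (memLp_translationSymbol y) (𝓕 (T f))] with ω e1 e2 e3 e4
  rw [e1, e3, e4, e2, mul_left_comm]

theorem dilationInvariant (h : HasHalfLineSymbol T c₁ c₂) : DilationInvariant T := by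
  intro a ha f
  apply fourier_L2_injective
  have h1 := h (dilateL2 a ha f)
  rw [fourier_dilateL2] at h1
  rw [fourier_dilateL2 ha (T f)]
  have hb := inv_pos.2 ha
  apply Lp.ext
  filter_upwards [h1, (quasiMeasurePreserving_mul_left hb.ne').ae (h f),
    coeFn_dilateL2 hb (𝓕 f), coeFn_dilateL2 hb (𝓕 (T f)),
    Lp.coeFn_smul ((a⁻¹ : ℝ) : ℂ) (dilateL2 a⁻¹ hb (𝓕 f)),
    Lp.coeFn_smul ((a⁻¹ : ℝ) : ℂ) (dilateL2 a⁻¹ hb (𝓕 (T f)))] with ω e1 e2 e3 e4 e5 e6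
  simp only [mul_pos_iff_of_pos_left hb] at e2
  rw [e1, e5, e6, Pi.smul_apply, Pi.smul_apply, e3, e4, e2, smul_eq_mul, smul_eq_mul,
    mul_left_comm]

theorem sub_smul (h : HasHalfLineSymbol T c₁ c₂) (h' : HasHalfLineSymbol T' d₁ d₂) (a b : ℂ) :
    HasHalfLineSymbol (a • T - b • T') (a * c₁ - b * d₁) (a * c₂ - b * d₂) := by
  intro f
  have e : 𝓕 ((a • T - b • T') f) = a • 𝓕 (T f) - b • 𝓕 (T' f) := by
    have := (Lp.fourierTransformₗᵢ ℝ ℂ).map_sub (a • T f) (b • T' f)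
    rw [LinearIsometryEquiv.map_smul, LinearIsometryEquiv.map_smul] at this
    exact this
  rw [e]
  filter_upwards [Lp.coeFn_sub (a • 𝓕 (T f)) (b • 𝓕 (T' f)), Lp.coeFn_smul a (𝓕 (T f)),
    Lp.coeFn_smul b (𝓕 (T' f)), h f, h' f] with ω e1 e2 e3 e4 e5
  rw [e1, Pi.sub_apply, e2, e3, Pi.smul_apply, Pi.smul_apply, e4, e5, smul_eq_mul, smul_eq_mul]
  split_ifs <;> ring

end HasHalfLineSymbol

/-! ### Symbol of the fractional Hilbert transform, and the reality condition -/

theorem hasHalfLineSymbol_hilbertTransform :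
    HasHalfLineSymbol hilbertTransform (-Complex.I) Complex.I := by
  intro f
  rw [hilbertTransform_eq]
  filter_upwards [coeFn_fourier_fourierMultiplierL2 memLp_hilbertSymbol f,
    Measure.ae_ne volume 0] with ω h1 h0
  rw [h1]
  split_ifs with hω
  · simp [Real.sign_of_pos hω]
  · simp [Real.sign_of_neg (lt_of_le_of_ne (not_lt.1 hω) h0)]

theorem hasHalfLineSymbol_fractional (θ : ℝ) :
    HasHalfLineSymbol ((Real.cos θ : ℂ) • ContinuousLinearMap.id ℂ L2R -
      (Real.sin θ : ℂ) • hilbertTransform) (Complex.exp (θ * Complex.I))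
      (starRingEnd ℂ (Complex.exp (θ * Complex.I))) := by
  have h := HasHalfLineSymbol.one.sub_smul hasHalfLineSymbol_hilbertTransform
    (Real.cos θ : ℂ) (Real.sin θ : ℂ)
  convert h using 1
  · rfl
  · rw [Complex.exp_mul_I, ← Complex.ofReal_cos, ← Complex.ofReal_sin]
    ring
  · rw [Complex.exp_mul_I, ← Complex.ofReal_cos, ← Complex.ofReal_sin, map_add, map_mul,
      Complex.conj_ofReal, Complex.conj_ofReal, Complex.conj_I]
    ring

theorem star_eq_self_iff_im_eq_zero (f : L2R) : star f = f ↔ ∀ᵐ x : ℝ, (f x).im = 0 := by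
  constructor
  · intro h
    have := Lp.coeFn_star f
    rw [h] at this
    filter_upwards [this] with x hx
    exact Complex.conj_eq_iff_im.1 hx.symm
  · intro h
    apply Lp.ext
    filter_upwards [h, Lp.coeFn_star f] with x h1 h2
    rw [h2]
    exact Complex.conj_eq_iff_im.2 h1

theorem star_add_smul_L2 (c : ℂ) (f g : L2R) :
    star (f + c • g) = star f + starRingEnd ℂ c • star g := by
  apply Lp.ext
  filter_upwards [Lp.coeFn_star (f + c • g), Lp.coeFn_star f, Lp.coeFn_star g,
    Lp.coeFn_add f (c • g), Lp.coeFn_smul c g, Lp.coeFn_add (star f) (starRingEnd ℂ c • star g),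
    Lp.coeFn_smul (starRingEnd ℂ c) (star g)] with x h1 h2 h3 h4 h5 h6 h7
  rw [h1, h6, Pi.star_apply, Pi.add_apply, h4, Pi.add_apply, h5, h7, h2, Pi.smul_apply,
    Pi.smul_apply, h3]
  simp

theorem mapsRealToReal_iff_map_star {T : L2R →L[ℂ] L2R} :
    MapsRealToReal T ↔ ∀ f, T (star f) = star (T f) := by
  simp only [MapsRealToReal, ← star_eq_self_iff_im_eq_zero]
  constructor
  · intro h f
    have key : ∀ a b : L2R, star a = a → star b = b →
        T (star (a + Complex.I • b)) = star (T (a + Complex.I • b)) := by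
      intro a b ha hb
      rw [star_add_smul_L2, ha, hb, map_add, map_add, map_smul, map_smul, star_add_smul_L2,
        h a ha, h b hb]
    have hst : ∀ (c d : ℂ), star (c • f + d • star f) =
        starRingEnd ℂ d • f + starRingEnd ℂ c • star f := by
      intro c d
      have h0 : star (0 : L2R) = 0 := (star_eq_self_iff_im_eq_zero 0).2 <|
        Filter.Eventually.of_forall fun x => by simp
      have h1 := star_add_smul_L2 c 0 f
      rw [zero_add, h0, zero_add] at h1
      rw [star_add_smul_L2, h1, star_star, add_comm]
    -- Real and imaginary parts of `f`.
    have := key ((1 / 2 : ℂ) • f + (1 / 2 : ℂ) • star f)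
      ((-Complex.I / 2) • f + (Complex.I / 2) • star f) (by rw [hst]; simp [Complex.conj_ofNat])
      (by rw [hst]; simp [Complex.conj_ofNat])
    have e : (1 / 2 : ℂ) • f + (1 / 2 : ℂ) • star f +
        Complex.I • ((-Complex.I / 2) • f + (Complex.I / 2) • star f) = f := by
      have e1 : Complex.I * (-Complex.I / 2) = 1 / 2 := by
        linear_combination (-1 / 2) * Complex.I_mul_I
      have e2 : Complex.I * (Complex.I / 2) = -(1 / 2) := by
        linear_combination (1 / 2) * Complex.I_mul_I
      rw [smul_add, smul_smul, smul_smul, e1, e2]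
      module
    rwa [e] at this
  · intro h f hf
    rw [← h, hf]

/-- Conjugating `f` conjugates its transform and reflects the frequency. Commuting with conjugation
therefore says that the symbol at `ω` is the conjugate of the symbol at `-ω`. -/
theorem HasHalfLineSymbol.mapsRealToReal_iff {T : L2R →L[ℂ] L2R} {c₁ c₂ : ℂ}
    (h : HasHalfLineSymbol T c₁ c₂) : MapsRealToReal T ↔ c₂ = starRingEnd ℂ c₁ := by
  rw [mapsRealToReal_iff_map_star]
  have hn := (Measure.measurePreserving_neg (volume : Measure ℝ)).quasiMeasurePreserving
  have h1 : ∀ f, ∀ᵐ ω : ℝ, (𝓕 (T (star f))) ω =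
      (if 0 < ω then c₁ else c₂) * starRingEnd ℂ ((𝓕 f) (-ω)) := fun f => by
    have := h (star f)
    rw [fourier_star_L2] at this
    filter_upwards [this, coeFn_reflectL2 (star (𝓕 f)), hn.ae (Lp.coeFn_star (𝓕 f))]
      with ω e1 e2 e3
    rw [e1, e2, e3]
    rfl
  have h2 : ∀ f, ∀ᵐ ω : ℝ, (𝓕 (star (T f))) ω =
      starRingEnd ℂ (if 0 < -ω then c₁ else c₂) * starRingEnd ℂ ((𝓕 f) (-ω)) := fun f => by
    rw [fourier_star_L2]
    filter_upwards [coeFn_reflectL2 (star (𝓕 (T f))), hn.ae (Lp.coeFn_star (𝓕 (T f))),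
      hn.ae (h f)] with ω e2 e3 e4
    rw [e2, e3, Pi.star_apply, e4, RCLike.star_def, map_mul]
  constructor
  · intro hT
    obtain ⟨f, hf⟩ := exists_fourier_ne_zero
    have h3 := h1 f
    rw [hT] at h3
    have key : ∀ᵐ ω : ℝ, (if 0 < ω then c₁ else c₂) = starRingEnd ℂ (if 0 < -ω then c₁ else c₂) := by
      filter_upwards [h3, h2 f, hn.ae hf] with ω e1 e2 e3
      exact mul_right_cancel₀ ((map_ne_zero (starRingEnd ℂ)).2 e3) (e1.symm.trans e2)
    obtain ⟨z, hz, hz'⟩ := exists_neg_of_ae key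
    simpa [hz, hz.not_gt] using hz'
  · intro hc f
    apply fourier_L2_injective
    apply Lp.ext
    filter_upwards [h1 f, h2 f, Measure.ae_ne volume 0] with ω e1 e2 h0
    rw [e1, e2]
    congr 1
    rcases lt_or_gt_of_ne h0 with hω | hω
    · simp [hω, hω.not_gt, hc]
    · simp [hω, hω.not_gt, hc]

end

/-! ### The classification -/

theorem theorem1 :
    (∀ T : L2R →L[ℂ] L2R,
      (T ∈ unitary (L2R →L[ℂ] L2R) ∧ MapsRealToReal T ∧
          TranslationInvariant T ∧ DilationInvariant T) ↔
        ∃! θ : ℝ, θ ∈ Set.Ioc (-Real.pi) Real.pi ∧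
          T = (Real.cos θ : ℂ) • ContinuousLinearMap.id ℂ L2R -
            (Real.sin θ : ℂ) • hilbertTransform) ∧
    (∀ T : L2R →L[ℂ] L2R,
      (T ∈ unitary (L2R →L[ℂ] L2R) ∧ TranslationInvariant T ∧ DilationInvariant T) ↔
        ∃! c : ℂ × ℂ, ‖c.1‖ = 1 ∧ ‖c.2‖ = 1 ∧ HasHalfLineSymbol T c.1 c.2) ∧
    (∀ c₁ c₂ : ℂ, ‖c₁‖ = 1 → ‖c₂‖ = 1 →
      ∃ T : L2R →L[ℂ] L2R, HasHalfLineSymbol T c₁ c₂) := by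
  refine ⟨fun T => ⟨?_, ?_⟩, fun T => ⟨?_, ?_⟩, fun c₁ c₂ _ _ =>
    ⟨_, hasHalfLineSymbol_fourierMultiplierL2 c₁ c₂⟩⟩
  · rintro ⟨hu, hr, ht, hd⟩
    obtain ⟨c₁, c₂, h⟩ := exists_hasHalfLineSymbol ht hd
    obtain rfl := h.mapsRealToReal_iff.1 hr
    have hc : Complex.exp (Complex.arg c₁ * Complex.I) = c₁ := by
      have := Complex.norm_mul_exp_arg_mul_I c₁
      rwa [(h.norm_eq_one hu).1, Complex.ofReal_one, one_mul] at this
    refine ⟨Complex.arg c₁, ⟨⟨Complex.neg_pi_lt_arg c₁, Complex.arg_le_pi c₁⟩, ?_⟩, ?_⟩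
    · refine h.operator_unique ?_
      have := hasHalfLineSymbol_fractional (Complex.arg c₁)
      rwa [hc] at this
    · rintro θ ⟨hθ, rfl⟩
      -- The symbol determines `exp (iθ)`, and `Complex.arg` recovers `θ` from it exactly because
      -- `θ` lies in `(-π, π]`.
      rw [(h.symbol_unique (hasHalfLineSymbol_fractional θ)).1, Complex.exp_mul_I,
        Complex.arg_cos_add_sin_mul_I hθ]
  · rintro ⟨θ, ⟨-, rfl⟩, -⟩
    have h := hasHalfLineSymbol_fractional θ
    have hn := Complex.norm_exp_ofReal_mul_I θ
    exact ⟨h.mem_unitary hn (by rw [RCLike.norm_conj, hn]), h.mapsRealToReal_iff.2 rfl,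
      h.translationInvariant, h.dilationInvariant⟩
  · rintro ⟨hu, ht, hd⟩
    obtain ⟨c₁, c₂, h⟩ := exists_hasHalfLineSymbol ht hd
    obtain ⟨h₁, h₂⟩ := h.norm_eq_one hu
    refine ⟨(c₁, c₂), ⟨h₁, h₂, h⟩, ?_⟩
    rintro ⟨d₁, d₂⟩ ⟨-, -, h'⟩
    exact Prod.ext (h'.symbol_unique h).1 (h'.symbol_unique h).2
  · rintro ⟨⟨c₁, c₂⟩, ⟨h₁, h₂, h⟩, -⟩
    exact ⟨h.mem_unitary h₁ h₂, h.translationInvariant, h.dilationInvariant⟩
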